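/- Let $n\ge 1$, let $0<a_1<\dots<a_{n+1}$ be real numbers, and let $Q=\{x\in\mathbb{R}^{n+1}:\sum_{i=1}^{n+1}x_i^2/a_i=1\}$. For $\mu\in\mathbb{R}\setminus\{a_1,\dots,a_{n+1}\}$ let $Q_\mu=\{x\in\mathbb{R}^{n+1}:\sum_{i=1}^{n+1}x_i^2/(a_i-\mu)=1\}$ be the nonsingular quadrics confocal to $Q$. A billiard trajectory inside $Q$ is given by its impact points $(q_k)_{k\in\mathbb{Z}}$: $q_k\in Q$, $q_{k+1}\ne q_k$, and for every $k$ the unit vector of $q_{k+2}-q_{k+1}$ is the mirror image, in the tangent hyperplane of $Q$ at $q_{k+1}$, of the unit vector of $q_{k+1}-q_k$. A quadric $Q_\mu$ as above is a nonsingular caustic of the trajectory if for every $k\in\mathbb{Z}$ the line through $q_k$ and $q_{k+1}$ is tangent to $Q_\mu$, where tangency at a point at infinity (an asymptotic line) is allowed. The trajectory is nonsingular if it has $n$ distinct nonsingular caustics. Suppose that a nonsingular billiard trajectory inside $Q$ has odd period, that is, there is an odd $m\ge 1$ such that $q_{k+m}=q_k$ for all $k\in\mathbb{Z}$. Then one of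 its nonsingular caustics is an ellipsoid. -/

import Mathlib

open scoped InnerProductSpace

namespace EllipticBilliard

/-- The Euclidean space of dimension `n + 1`. -/
abbrev Space (n : ℕ) : Type := EuclideanSpace ℝ (Fin (n + 1))

/-- The centred quadric `∑ xᵢ² / bᵢ = 1` with principal axes along the coordinate axes. -/
def quadric {n : ℕ} (b : Fin (n + 1) → ℝ) : Set (Space n) :=
  {x | ∑ i, x i ^ 2 / b i = 1}

/-- The quadric `Q_μ` confocal to `Q = quadric a`; it is meaningful when `μ` is none of the
`a i`, and `Q_0 = Q`. -/
def confocalQuadric {n : ℕ} (a : Fin (n + 1) → ℝ) (μ : ℝ) : Set (Space n) :=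
  quadric fun i => a i - μ

/-- A set is an ellipsoid (with principal axes along the coordinate axes, as for every quadric of
a confocal family) when it is `∑ xᵢ² / bᵢ = 1` with all `bᵢ` positive. -/
def IsEllipsoid {n : ℕ} (S : Set (Space n)) : Prop :=
  ∃ b : Fin (n + 1) → ℝ, (∀ i, 0 < b i) ∧ S = quadric b

/-- The normal vector `(xᵢ / aᵢ)` to the ellipsoid `quadric a` at its point `x`. -/
noncomputable def normal {n : ℕ} (a : Fin (n + 1) → ℝ) (x : Space n) : Space n :=
  WithLp.toLp 2 fun i => x i / a i

/-- The unit vector pointing from `x` to `y` (used for `x ≠ y`). -/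
noncomputable def unitDir {n : ℕ} (x y : Space n) : Space n :=
  ‖y - x‖⁻¹ • (y - x)

/-- A (two-sided) billiard trajectory inside the ellipsoid `quadric a`, given by its impact points:
they lie on the ellipsoid, consecutive ones are distinct, and at every impact the outgoing unit
velocity is the mirror image of the incoming one in the tangent hyperplane. -/
structure IsTrajectory {n : ℕ} (a : Fin (n + 1) → ℝ) (q : ℤ → Space n) : Prop where
  mem : ∀ k, q k ∈ quadric a
  ne : ∀ k, q k ≠ q (k + 1)
  reflect : ∀ k, unitDir (q (k + 1)) (q (k + 2)) =
    ((ℝ ∙ normal a (q (k + 1)))ᗮ).reflection (unitDir (q k) (q (k + 1)))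

/-- The polar bilinear form `∑ uᵢ wᵢ / (aᵢ - μ)` of the quadratic part of the equation of `Q_μ`. -/
noncomputable def polar {n : ℕ} (a : Fin (n + 1) → ℝ) (μ : ℝ) (u w : Space n) : ℝ :=
  ∑ i, u i * w i / (a i - μ)

/-- The line through `x` with direction `v ≠ 0` is tangent to the nonsingular quadric `Q_μ`,
in the projective sense: either it passes through a point `y` of `Q_μ` and its direction lies in
the tangent hyperplane of `Q_μ` at `y`, or it is tangent to `Q_μ` at infinity (an asymptote), i.e.
its point at infinity lies on the projective closure of `Q_μ`, and the tangent hyperplane there,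
with equation `polar a μ v z = 0`, contains the line. -/
def LineTangent {n : ℕ} (a : Fin (n + 1) → ℝ) (μ : ℝ) (x v : Space n) : Prop :=
  (∃ t : ℝ, x + t • v ∈ confocalQuadric a μ ∧ polar a μ (x + t • v) v = 0) ∨
    (polar a μ v v = 0 ∧ polar a μ v x = 0)

/-- `Q_μ` is a nonsingular caustic of the trajectory `q`: it is a nonsingular element of the
confocal family, and every line of the trajectory is tangent to it. -/
def IsNonsingularCaustic {n : ℕ} (a : Fin (n + 1) → ℝ) (q : ℤ → Space n) (μ : ℝ) : Prop :=
  (∀ i, μ ≠ a i) ∧ ∀ k, LineTangent a μ (q k) (q (k + 1) - q k)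

/-- The trajectory `q` in dimension `n + 1` has `n` distinct nonsingular caustics. -/
def IsNonsingular {n : ℕ} (a : Fin (n + 1) → ℝ) (q : ℤ → Space n) : Prop :=
  ∃ l : Fin n → ℝ, StrictMono l ∧ ∀ i, IsNonsingularCaustic a q (l i)

end EllipticBilliard

namespace EllipticBilliard

open Polynomial

variable {n : ℕ}

/-! Suppose every caustic parameter is at least `a 0`. For a chord of `Q`, the discriminant has only
simple poles in `μ` (`discrim_eq_sum`), so its numerator has degree at most `n` and its roots are
exactly the `n` caustic parameters. It is positive at `0` and has no root up to `a 0`, hence the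
residue at `a 0` is positive (`residue_zero_pos`). This forces the chord to cross `x₀ = 0` inside
`Q` (`mul_neg_of_residue_zero_pos`). So `x₀` changes sign at every impact, which rules out an odd
period. -/

/-- A quarter of the discriminant of the quadratic equation for the intersection of the line through
`x` with direction `v` and the quadric `Q_μ`. -/
noncomputable def discrim (a : Fin (n + 1) → ℝ) (μ : ℝ) (x v : Space n) : ℝ :=
  polar a μ x v ^ 2 - polar a μ v v * (polar a μ x x - 1)

/-- The coefficient of `1 / (a i - μ)` in the partial fraction expansion of `discrim a μ x v`. -/
noncomputable def residue (a : Fin (n + 1) → ℝ) (x v : Space n) (i : Fin (n + 1)) : ℝ :=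
  v i ^ 2 - ∑ j, (x i * v j - x j * v i) ^ 2 / (a j - a i)

/-- The numerator of `discrim a μ x v`, as a polynomial in `μ`. -/
noncomputable def numerator (a : Fin (n + 1) → ℝ) (x v : Space n) : ℝ[X] :=
  ∑ i, C (residue a x v i) * ∏ j ∈ Finset.univ.erase i, (C (a j) - X)

/-! ### The discriminant as a rational function of `μ` -/

theorem polar_add_smul_right (a : Fin (n + 1) → ℝ) (μ t : ℝ) (x v w : Space n) :
    polar a μ w (x + t • v) = polar a μ w x + t * polar a μ w v := by
  simp only [polar, Finset.mul_sum, ← Finset.sum_add_distrib]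
  refine Finset.sum_congr rfl fun i _ => ?_
  simp only [PiLp.add_apply, PiLp.smul_apply, smul_eq_mul]
  ring

theorem polar_comm (a : Fin (n + 1) → ℝ) (μ : ℝ) (u w : Space n) :
    polar a μ u w = polar a μ w u := by
  simp only [polar, mul_comm]

theorem mem_confocalQuadric_iff (a : Fin (n + 1) → ℝ) (μ : ℝ) (x : Space n) :
    x ∈ confocalQuadric a μ ↔ polar a μ x x = 1 := by
  simp only [confocalQuadric, quadric, polar, Set.mem_ofPred_eq, sq]

theorem mem_quadric_iff (a : Fin (n + 1) → ℝ) (x : Space n) :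
    x ∈ quadric a ↔ polar a 0 x x = 1 := by
  simp only [quadric, polar, Set.mem_ofPred_eq, sq, sub_zero]

theorem LineTangent.discrim_eq_zero {a : Fin (n + 1) → ℝ} {μ : ℝ} {x v : Space n}
    (h : LineTangent a μ x v) : discrim a μ x v = 0 := by
  unfold discrim
  rcases h with ⟨t, h₁, h₂⟩ | ⟨h₁, h₂⟩
  · rw [mem_confocalQuadric_iff, polar_add_smul_right, polar_comm a μ (x + t • v) x,
      h₂, polar_add_smul_right] at h₁
    rw [polar_comm, polar_add_smul_right, polar_comm a μ v x] at h₂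
    linear_combination (polar a μ x v) * h₂ - polar a μ v v * h₁
  · rw [h₁, polar_comm, h₂]
    ring

/-- Lagrange's identity writes the discriminant through the minors `x i * v j - x j * v i`. These
vanish for `i = j`, so there are no double poles. -/
theorem discrim_eq_sum {a : Fin (n + 1) → ℝ} (ha : Function.Injective a) {μ : ℝ}
    (hμ : ∀ i, μ ≠ a i) (x v : Space n) :
    discrim a μ x v = ∑ i, residue a x v i / (a i - μ) := by
  have hne : ∀ i, a i - μ ≠ 0 := fun i => sub_ne_zero.2 (hμ i).symm
  have key : ∑ i, ∑ j, (x i * v j - x j * v i) ^ 2 / ((a i - μ) * (a j - μ)) =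
      2 * ∑ i, ∑ j, (x i * v j - x j * v i) ^ 2 / (a j - a i) / (a i - μ) := by
    rw [two_mul]
    -- Swapping indices in one copy pairs the terms into the partial fractions of `1 / ((a i - μ) *
    -- (a j - μ))`.
    nth_rw 3 [Finset.sum_comm]
    simp only [← Finset.sum_add_distrib]
    refine Finset.sum_congr rfl fun i _ => Finset.sum_congr rfl fun j _ => ?_
    rcases eq_or_ne i j with rfl | hij
    · simp
    · have h₁ : a i - a j ≠ 0 := sub_ne_zero.2 (ha.ne hij)
      have h₂ : a j - a i ≠ 0 := sub_ne_zero.2 (ha.ne hij.symm)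
      have h₃ := hne i
      have h₄ := hne j
      rw [show a i - a j = -(a j - a i) by ring]
      field_simp
      ring
  have lagrange : ∑ i, ∑ j, (x i * v j - x j * v i) ^ 2 / ((a i - μ) * (a j - μ)) =
      2 * (polar a μ x x * polar a μ v v - polar a μ x v ^ 2) := by
    have expand : ∀ i j, (x i * v j - x j * v i) ^ 2 / ((a i - μ) * (a j - μ)) =
        x i * x i / (a i - μ) * (v j * v j / (a j - μ)) +
        v i * v i / (a i - μ) * (x j * x j / (a j - μ)) -
        2 * (x i * v i / (a i - μ) * (x j * v j / (a j - μ))) := by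
      intro i j
      have h₃ := hne i
      have h₄ := hne j
      field_simp
      ring
    simp only [expand, Finset.sum_sub_distrib, Finset.sum_add_distrib, ← Finset.mul_sum,
      ← Finset.sum_mul]
    simp only [polar]
    ring
  have split : ∑ i, residue a x v i / (a i - μ) = polar a μ v v -
      ∑ i, ∑ j, (x i * v j - x j * v i) ^ 2 / (a j - a i) / (a i - μ) := by
    simp only [residue, sub_div, Finset.sum_sub_distrib, Finset.sum_div, polar, sq]
  rw [split, discrim]
  linarith

theorem eval_numerator {a : Fin (n + 1) → ℝ} (ha : Function.Injective a) {μ : ℝ}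
    (hμ : ∀ i, μ ≠ a i) (x v : Space n) :
    (numerator a x v).eval μ = discrim a μ x v * ∏ i, (a i - μ) := by
  rw [discrim_eq_sum ha hμ, Finset.sum_mul, numerator, eval_finsetSum]
  refine Finset.sum_congr rfl fun i _ => ?_
  have : a i - μ ≠ 0 := sub_ne_zero.2 (hμ i).symm
  rw [← Finset.mul_prod_erase _ _ (Finset.mem_univ i)]
  simp only [eval_mul, eval_C, eval_prod, eval_sub, eval_X]
  field_simp

theorem eval_numerator_self (a : Fin (n + 1) → ℝ) (x v : Space n) (i : Fin (n + 1)) :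
    (numerator a x v).eval (a i) =
      residue a x v i * ∏ j ∈ Finset.univ.erase i, (a j - a i) := by
  rw [numerator, eval_finsetSum, Finset.sum_eq_single i]
  · simp only [eval_mul, eval_C, eval_prod, eval_sub, eval_X]
  · intro k _ hk
    simp only [eval_mul, eval_C, eval_prod, eval_sub, eval_X]
    rw [Finset.prod_eq_zero (Finset.mem_erase.2 ⟨hk.symm, Finset.mem_univ i⟩) (sub_self _),
      mul_zero]
  · simp

theorem natDegree_numerator_le (a : Fin (n + 1) → ℝ) (x v : Space n) :
    (numerator a x v).natDegree ≤ n := by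
  refine natDegree_sum_le_of_forall_le _ _ fun i _ => (natDegree_C_mul_le _ _).trans ?_
  refine (natDegree_prod_le _ _).trans ((Finset.sum_le_card_nsmul _ _ 1 fun j _ => ?_).trans ?_)
  · exact (natDegree_sub_le _ _).trans (by simp)
  · simp [Finset.card_erase_of_mem]

/-! ### Chords of the ellipsoid -/

theorem polar_self_pos {a : Fin (n + 1) → ℝ} (ha : ∀ i, 0 < a i) {v : Space n} (hv : v ≠ 0) :
    0 < polar a 0 v v := by
  obtain ⟨i, hi⟩ : ∃ i, v i ≠ 0 := by
    by_contra! h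
    exact hv (by ext i; exact h i)
  refine Finset.sum_pos' (fun j _ => ?_) ⟨i, Finset.mem_univ i, ?_⟩
  · rw [sub_zero]
    exact div_nonneg (mul_self_nonneg _) (ha j).le
  · rw [sub_zero]
    exact div_pos (mul_self_pos.2 hi) (ha i)

/-- The second-degree equation satisfied by the two ends of a chord of the ellipsoid. -/
theorem two_mul_polar_add_polar {a : Fin (n + 1) → ℝ} {x v : Space n} (hx : x ∈ quadric a)
    (hxv : x + v ∈ quadric a) : 2 * polar a 0 x v + polar a 0 v v = 0 := by
  rw [mem_quadric_iff] at hx hxv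
  rw [← one_smul ℝ v, polar_add_smul_right, one_smul, polar_comm a 0 _ x, polar_comm a 0 _ v] at hxv
  have h₁ := polar_add_smul_right a 0 1 x v x
  have h₂ := polar_add_smul_right a 0 1 x v v
  rw [one_smul] at h₁ h₂
  rw [h₁, h₂, polar_comm a 0 v x] at hxv
  linarith

/-- The line meets `Q` at two distinct parameters, `0` and `1`. -/
theorem discrim_zero_pos {a : Fin (n + 1) → ℝ} (ha : ∀ i, 0 < a i) {x v : Space n}
    (hx : x ∈ quadric a) (hxv : x + v ∈ quadric a) (hv : v ≠ 0) : 0 < discrim a 0 x v := by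
  have h := two_mul_polar_add_polar hx hxv
  have hpos := polar_self_pos ha hv
  rw [mem_quadric_iff] at hx
  rw [discrim, hx, sub_self, mul_zero, sub_zero]
  have : polar a 0 x v ≠ 0 := by
    intro h0
    linarith
  positivity

/-- If a chord of the ellipsoid is tangent to `n` distinct confocal quadrics which are not
ellipsoids, then the numerator of its discriminant is positive at the smallest pole. -/
theorem residue_zero_pos {a : Fin (n + 1) → ℝ} (ha0 : 0 < a 0) (ha : StrictMono a)
    {x v : Space n} (hx : x ∈ quadric a) (hxv : x + v ∈ quadric a) (hv : v ≠ 0)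
    {l : Fin n → ℝ} (hl : Function.Injective l) (hne : ∀ i j, l i ≠ a j) (hla : ∀ i, a 0 ≤ l i)
    (ht : ∀ i, LineTangent a (l i) x v) : 0 < residue a x v 0 := by
  have hapos : ∀ i, 0 < a i := fun i => ha0.trans_le (ha.monotone (Fin.zero_le i))
  have hzero : 0 < (numerator a x v).eval 0 := by
    rw [eval_numerator ha.injective fun i => (hapos i).ne]
    exact mul_pos (discrim_zero_pos hapos hx hxv hv)
      (Finset.prod_pos fun i _ => by simpa using hapos i)
  have hroot : ∀ μ, μ ≤ a 0 → (numerator a x v).eval μ ≠ 0 := by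
    intro μ hμ h0
    have hlt : ∀ i, μ < l i := fun i => hμ.trans_lt (lt_of_le_of_ne (hla i) (hne i 0).symm)
    -- With `μ` added to the `l i`, the numerator would have `n + 1` distinct roots.
    have hinj : Function.Injective (Fin.cons μ l : Fin (n + 1) → ℝ) :=
      Fin.cons_injective_iff.2 ⟨fun ⟨i, hi⟩ => (hlt i).ne' hi, hl⟩
    have := eq_zero_of_natDegree_lt_card_of_eval_eq_zero (numerator a x v) hinj
      (fun i => by
        refine Fin.cases h0 (fun j => ?_) i
        rw [Fin.cons_succ, eval_numerator ha.injective (hne j), (ht j).discrim_eq_zero, zero_mul])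
      (by simpa using Nat.lt_succ_of_le (natDegree_numerator_le a x v))
    simp [this] at hzero
  have hpos : 0 < (numerator a x v).eval (a 0) := by
    by_contra! hle
    obtain ⟨μ, hμ, h0⟩ := intermediate_value_Icc' ha0.le
      (numerator a x v).continuous.continuousOn ⟨hle, hzero.le⟩
    exact hroot μ hμ.2 h0
  rw [eval_numerator_self] at hpos
  refine pos_of_mul_pos_left hpos (Finset.prod_nonneg fun j _ => ?_)
  exact sub_nonneg.2 (ha.monotone (Fin.zero_le j))

/-- A chord of the ellipsoid whose residue at `a 0` is positive crosses the hyperplane `x₀ = 0`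
strictly inside the ellipsoid. -/
theorem mul_neg_of_residue_zero_pos {a : Fin (n + 1) → ℝ} (ha0 : 0 < a 0) (ha : StrictMono a)
    {x v : Space n} (hx : x ∈ quadric a) (hxv : x + v ∈ quadric a)
    (hres : 0 < residue a x v 0) : x 0 * (x + v) 0 < 0 := by
  have hapos : ∀ i, 0 < a i := fun i => ha0.trans_le (ha.monotone (Fin.zero_le i))
  have hnonneg : ∀ j, 0 ≤ (x 0 * v j - x j * v 0) ^ 2 / (a j - a 0) := fun j =>
    div_nonneg (sq_nonneg _) (sub_nonneg.2 (ha.monotone (Fin.zero_le j)))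
  have hv0 : v 0 ≠ 0 := by
    intro h
    have := Finset.sum_nonneg fun j (_ : j ∈ Finset.univ) => hnonneg j
    rw [residue, h] at hres
    rw [h] at this
    linarith
  have hv : v ≠ 0 := by
    rintro rfl
    exact hv0 rfl
  -- Enlarging the denominators passes from the focal quadric in `x₀ = 0` to `Q` itself; the term `j
  -- = 0` is zero on both sides.
  have hle : ∑ j, (x 0 * v j - x j * v 0) ^ 2 / a j ≤
      ∑ j, (x 0 * v j - x j * v 0) ^ 2 / (a j - a 0) := by
    refine Finset.sum_le_sum fun j _ => ?_
    rcases eq_or_ne j 0 with rfl | hj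
    · simp
    · have : 0 < a j - a 0 := sub_pos.2 (ha (Fin.pos_iff_ne_zero.2 hj))
      gcongr
      linarith
  have hexp : ∑ j, (x 0 * v j - x j * v 0) ^ 2 / a j =
      x 0 ^ 2 * polar a 0 v v - 2 * (x 0 * v 0) * polar a 0 x v + v 0 ^ 2 * polar a 0 x x := by
    simp only [polar, Finset.mul_sum, ← Finset.sum_add_distrib, ← Finset.sum_sub_distrib]
    refine Finset.sum_congr rfl fun j _ => ?_
    rw [sub_zero]
    ring
  have hchord := two_mul_polar_add_polar hx hxv
  have hpos := polar_self_pos hapos hv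
  rw [mem_quadric_iff] at hx
  rw [residue] at hres
  -- By `hexp` and the chord equation, the left side is the sum over `a j` minus `v 0 ^ 2`.
  have hprod : polar a 0 v v * (x 0 * (x + v) 0) < 0 := by
    rw [PiLp.add_apply]
    have : polar a 0 v v * (x 0 * (x 0 + v 0)) =
        x 0 ^ 2 * polar a 0 v v - 2 * (x 0 * v 0) * polar a 0 x v := by
      linear_combination (x 0 * v 0) * hchord
    rw [hx] at hexp
    linarith
  exact lt_of_not_ge fun h => hprod.not_ge (mul_nonneg hpos.le h)

theorem isEllipsoid_confocalQuadric {a : Fin (n + 1) → ℝ} (ha : StrictMono a) {μ : ℝ}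
    (hμ : μ < a 0) : IsEllipsoid (confocalQuadric a μ) :=
  ⟨fun i => a i - μ, fun i => sub_pos.2 (hμ.trans_le (ha.monotone (Fin.zero_le i))), rfl⟩

/-- A sequence of reals that changes sign at every step has no odd period. -/
theorem even_of_mul_succ_neg {s : ℕ → ℝ} (hs : ∀ k, s k * s (k + 1) < 0) {m : ℕ}
    (hm : s m = s 0) : Even m := by
  have h0 : s 0 ≠ 0 := fun h => by simpa [h] using hs 0
  have alt : ∀ k, 0 < (-1) ^ k * (s 0 * s k) := by
    intro k
    induction k with
    | zero => simpa using mul_self_pos.2 h0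
    | succ k ih =>
      have hk : s k ≠ 0 := fun h => by simpa [h] using hs k
      have := mul_pos ih (neg_pos.2 (hs k))
      have h : (-1) ^ k * (s 0 * s k) * -(s k * s (k + 1)) =
          (-1) ^ (k + 1) * (s 0 * s (k + 1)) * (s k) ^ 2 := by ring
      rw [h] at this
      exact pos_of_mul_pos_left this (sq_nonneg _)
  by_contra hodd
  have := alt m
  rw [hm, (Nat.not_even_iff_odd.1 hodd).neg_one_pow] at this
  nlinarith [mul_self_nonneg (s 0)]

end EllipticBilliard

theorem corollary3p1 (n : ℕ) (hn : 1 ≤ n) (a : Fin (n + 1) → ℝ) (ha0 : 0 < a 0)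
    (ha : StrictMono a) (q : ℤ → EllipticBilliard.Space n)
    (hq : EllipticBilliard.IsTrajectory a q) (hns : EllipticBilliard.IsNonsingular a q)
    (m : ℕ) (hm : Odd m) (hper : ∀ k : ℤ, q (k + m) = q k) :
    ∃ μ : ℝ, EllipticBilliard.IsNonsingularCaustic a q μ ∧
      EllipticBilliard.IsEllipsoid (EllipticBilliard.confocalQuadric a μ) := by
  obtain ⟨l, hl, hcaustic⟩ := hns
  by_contra! hcon
  have hla : ∀ i, a 0 ≤ l i := fun i => by
    by_contra! hlt
    exact hcon (l i) (hcaustic i) (EllipticBilliard.isEllipsoid_confocalQuadric ha hlt)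
  have hneg : ∀ k : ℤ, q k 0 * q (k + 1) 0 < 0 := fun k => by
    have hsum : q k + (q (k + 1) - q k) = q (k + 1) := add_sub_cancel _ _
    have hmem : q k + (q (k + 1) - q k) ∈ EllipticBilliard.quadric a := by
      rw [hsum]
      exact hq.mem (k + 1)
    have hres := EllipticBilliard.residue_zero_pos ha0 ha (hq.mem k) hmem
      (sub_ne_zero.2 (hq.ne k).symm) hl.injective (fun i => (hcaustic i).1) hla
      fun i => (hcaustic i).2 k
    have := EllipticBilliard.mul_neg_of_residue_zero_pos ha0 ha (hq.mem k) hmem hres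
    rwa [hsum] at this
  have heven : Even m := EllipticBilliard.even_of_mul_succ_neg (s := fun k : ℕ => q k 0)
    (fun k => by simpa using hneg k) (by simpa using congrArg (fun p => p 0) (hper 0))
  exact Nat.not_even_iff_odd.2 hm heven
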